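/- Fix a finite input alphabet $\Sigma$. The input $x\in\Sigma^*$ is written on a read-only tape between two occurrences of an end-marker, and heads on it start on the left end-marker and never leave the marked part of the tape. A *verifier* is a probabilistic Turing machine with an input head, one read/write work tape (finite alphabet, initially blank) and a communication cell with finite alphabet $\Gamma\ni\epsilon$. It has finitely many coin-tossing states and deterministic states, one of which is the start state, and two halting states *accept* and *reject*. Each non-halting state $q$ has a symbol $\gamma_q\in\Gamma$. In state $q$, if $\gamma_q\neq\epsilon$, the verifier writes $\gamma_q$ in the cell and the prover replaces it by an answer $\gamma\in\Gamma$; if $\gamma_q=\epsilon$, there is no communication and $\gamma:=\epsilon$. Then the next state, the symbol written on the work tape and the movements ($-1$, $0$ or $+1$) of the two heads are determined by $q$, the symbols scanned on the two tapes, $\gamma$ and, if $q$ is coin-tossing, a fresh fair random bit. A *prover* is an arbitrary function that determines the answer from the input and the entire communication so far. A *one-way prover* maps each input to an infinite sequence over $\Gamma$ and gives the $i$-th symbol of this sequence as its answer in the $i$-th communication step. A language $L\subseteq\Sigma^*$ is in $\mathsf{IP}(\text{cons-space},\text{cons-random-bits},\text{1way-input})$ if there are a verifier $V$ whose input head never moves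 left, and constants $s,r\in\mathbb N$ and $0\le\varepsilon<\tfrac12$, such that * in every run, for every input and every prover, $V$ visits at most $s$ work tape cells and tosses at most $r$ coins; * there is a prover $P$ such that for every $x\in L$ the interaction of $P$ and $V$ on $x$ ends in acceptance with probability at least $1-\varepsilon$; * for every $x\notin L$ and every prover $P^*$, the interaction of $P^*$ and $V$ on $x$ ends in rejection with probability at least $1-\varepsilon$. The class $\mathsf{oneway\text{-}IP}(\text{cons-space},\text{cons-random-bits},\text{1way-input})$ is defined in the same way, with "prover" replaced by "one-way prover" throughout. For $k\ge1$, $\mathsf{1NFA}(k)$ is the class of languages over $\Sigma$ that are recognized by nondeterministic finite automata with $k$ heads on the input tape, each of which may stay put or move right, but not left, in each step. (Such an automaton accepts $x$ if some computation on $x$ reaches an accepting state.) **Theorem.** $$\mathsf{oneway\text{-}IP}(\text{cons-space},\text{cons-random-bits},\text{1way-input})=\mathsf{IP}(\text{cons-space},\text{cons-random-bits},\text{1way-input})=\bigcup_{k\ge1}\mathsf{1NFA}(k).$$ -/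

import Mathlib

open MeasureTheory

/-- The symbol in cell `i` of the tape that holds `x` between two end-markers. Cells `1, …, |x|` hold
the letters of `x`, and `none` is the end-marker, found in the cells `0` and `|x| + 1`. (The machines
below never leave the cells `0, …, |x| + 1`.) -/
def tapeSymbol {α : Type} (x : List α) (i : ℤ) : Option α :=
  if 1 ≤ i then x[(i - 1).toNat]? else none

/-- Cell `i` is one of the cells of the tape that holds `x` between two end-markers. -/
def OnTape {α : Type} (x : List α) (i : ℤ) : Prop :=
  0 ≤ i ∧ i ≤ (x.length : ℤ) + 1

/-! ### Verifiers and provers -/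

/-- The states of a verifier: coin-tossing states (`R`) and deterministic states (`D`), in which it runs,
and the two halting states. -/
inductive VState (R D : Type) : Type
  | run (q : R ⊕ D)
  | accept
  | reject

/-- A verifier: a probabilistic Turing machine with a read-only input tape over `α`, one read/write work
tape and a communication cell. Head movements are elements `-1, 0, 1` of `SignType`. A value
`(q', θ', d, e)` of a transition function says: go to state `q'`, write `θ'` on the work tape, move the
input head by `d` and the work head by `e`. -/
structure Verifier (α : Type) where
  /-- coin-tossing states -/
  R : Type
  /-- deterministic (non-halting) states -/
  D : Type
  /-- communication alphabet -/
  Γ : Type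
  /-- work tape alphabet -/
  Θ : Type
  finite_R : Finite R
  finite_D : Finite D
  finite_Γ : Finite Γ
  finite_Θ : Finite Θ
  /-- the null symbol of the communication alphabet -/
  null : Γ
  /-- the blank symbol of the work tape -/
  blank : Θ
  start : R ⊕ D
  /-- the communication symbol of a state; the state communicates iff this is not `null` -/
  sym : R ⊕ D → Γ
  /-- arguments: state, input symbol, work symbol, prover's symbol, random bit -/
  tossStep : R → Option α → Θ → Γ → Bool → VState R D × Θ × SignType × SignType
  /-- arguments: state, input symbol, work symbol, prover's symbol -/
  detStep : D → Option α → Θ → Γ → VState R D × Θ × SignType × SignType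

/-- A prover: its answer depends on the input, on the whole communication so far (the list of all
earlier pairs of a verifier symbol and the answer to it, latest first), and on the symbol that the
verifier has just written. -/
def Prover (α Γ : Type) : Type := List α → List (Γ × Γ) → Γ → Γ

/-- A prover is one-way if it maps every input `x` to a sequence `c x` of symbols, whose `i`-th symbol is
its answer in the `i`-th communication step, whatever the verifier writes. -/
def Prover.IsOneWay {α Γ : Type} (P : Prover α Γ) : Prop :=
  ∃ c : List α → ℕ → Γ, ∀ x h g, P x h g = c x h.length

namespace Verifier

variable {α : Type} (V : Verifier α)

/-- A configuration of the verifier. -/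
structure Config where
  state : VState V.R V.D
  inputHead : ℤ
  work : ℤ → V.Θ
  workHead : ℤ

/-- A configuration, together with the communication so far (latest exchange first) and the number of
coins tossed so far. -/
structure Snapshot extends Config V where
  history : List (V.Γ × V.Γ)
  coins : ℕ

/-- The beginning of a run. -/
def init : V.Snapshot where
  state := .run V.start
  inputHead := 0
  work := fun _ => V.blank
  workHead := 0
  history := []
  coins := 0

open Classical in
/-- The prover's symbol that the verifier sees in state `q`, and the communication history afterwards.
If the symbol of `q` is `null` then there is no communication. -/
noncomputable def exchange (P : Prover α V.Γ) (x : List α) (q : V.R ⊕ V.D)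
    (h : List (V.Γ × V.Γ)) : V.Γ × List (V.Γ × V.Γ) :=
  if V.sym q = V.null then (V.null, h)
  else (P x h (V.sym q), (V.sym q, P x h (V.sym q)) :: h)

/-- Carry out a value of a transition function. -/
noncomputable def perform (c : V.Snapshot) (a : VState V.R V.D × V.Θ × SignType × SignType)
    (h : List (V.Γ × V.Γ)) (coins : ℕ) : V.Snapshot where
  state := a.1
  inputHead := c.inputHead + (a.2.2.1 : ℤ)
  work := Function.update c.work c.workHead a.2.1
  workHead := c.workHead + (a.2.2.2 : ℤ)
  history := h
  coins := coins

/-- One step of the verifier, against the prover `P`, on input `x`, where `ω` is the sequence of outcomes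
of the coin tosses. Nothing changes after halting. -/
noncomputable def step (P : Prover α V.Γ) (x : List α) (ω : ℕ → Bool) (c : V.Snapshot) : V.Snapshot :=
  match c.state with
  | .run (.inl q) =>
      V.perform c
        (V.tossStep q (tapeSymbol x c.inputHead) (c.work c.workHead)
          (V.exchange P x (.inl q) c.history).1 (ω c.coins))
        (V.exchange P x (.inl q) c.history).2 (c.coins + 1)
  | .run (.inr q) =>
      V.perform c
        (V.detStep q (tapeSymbol x c.inputHead) (c.work c.workHead)
          (V.exchange P x (.inr q) c.history).1)
        (V.exchange P x (.inr q) c.history).2 c.coins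
  | .accept => c
  | .reject => c

/-- The situation after `t` steps. -/
noncomputable def after (P : Prover α V.Γ) (x : List α) (ω : ℕ → Bool) (t : ℕ) : V.Snapshot :=
  (V.step P x ω)^[t] V.init

end Verifier

/-- The law of a sequence of independent fair coin tosses. -/
noncomputable def coinMeasure : Measure (ℕ → Bool) :=
  Measure.infinitePi fun _ => (PMF.uniformOfFintype Bool).toMeasure

namespace Verifier

variable {α : Type} (V : Verifier α)

/-- The probability that the interaction of `P` and `V` on input `x` results in acceptance. -/
noncomputable def acceptProb (P : Prover α V.Γ) (x : List α) : ℝ :=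
  coinMeasure.real {ω | ∃ t, (V.after P x ω t).state = .accept}

/-- The probability that the interaction of `P` and `V` on input `x` results in rejection. -/
noncomputable def rejectProb (P : Prover α V.Γ) (x : List α) : ℝ :=
  coinMeasure.real {ω | ∃ t, (V.after P x ω t).state = .reject}

/-! In the following definitions, `S` is the set of the provers that are considered: all provers, or all
one-way provers. -/

/-- `V`, against provers from `S`, is the verifier of an interactive proof system (in the strong sense)
for `L` with error probability `ε`. -/
def IsProofSystem (S : Set (Prover α V.Γ)) (L : Language α) (ε : ℝ) : Prop :=
  (∃ P ∈ S, ∀ x ∈ L, 1 - ε ≤ V.acceptProb P x) ∧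
    ∀ x ∉ L, ∀ P ∈ S, 1 - ε ≤ V.rejectProb P x

/-- The input head never moves beyond the end-markers. -/
def StaysOnTape (S : Set (Prover α V.Γ)) : Prop :=
  ∀ P ∈ S, ∀ x ω t, OnTape x (V.after P x ω t).inputHead

/-- The number of work tape cells that are visited is bounded by a constant, in the worst case. -/
def ConsSpace (S : Set (Prover α V.Γ)) : Prop :=
  ∃ s : ℕ, ∀ P ∈ S, ∀ x ω, (Set.range fun t => (V.after P x ω t).workHead).encard ≤ s

/-- The number of coins that are tossed is bounded by a constant, in the worst case. -/
def ConsRandomBits (S : Set (Prover α V.Γ)) : Prop :=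
  ∃ r : ℕ, ∀ P ∈ S, ∀ x ω t, (V.after P x ω t).coins ≤ r

/-- The input head is not allowed to move left. -/
def OneWayInput : Prop :=
  (∀ q σ θ γ b, (V.tossStep q σ θ γ b).2.2.1 ≠ -1) ∧ ∀ q σ θ γ, (V.detStep q σ θ γ).2.2.1 ≠ -1

/-- `V` shows, against provers from `S`, that `L` has an interactive proof system with constant space,
constantly many random bits, a one-way input head and an error probability below `1 / 2`. -/
def Verifies (S : Set (Prover α V.Γ)) (L : Language α) : Prop :=
  V.StaysOnTape S ∧ V.ConsSpace S ∧ V.ConsRandomBits S ∧ V.OneWayInput ∧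
    ∃ ε : ℝ, 0 ≤ ε ∧ ε < 1 / 2 ∧ V.IsProofSystem S L ε

end Verifier

/-- The class `IP(cons-space, cons-random-bits, 1way-input)` over the alphabet `α`. -/
def IPConsOneWayInput (α : Type) : Set (Language α) :=
  {L | ∃ V : Verifier α, V.Verifies Set.univ L}

/-- The class `oneway-IP(cons-space, cons-random-bits, 1way-input)` over the alphabet `α`. -/
def OneWayIPConsOneWayInput (α : Type) : Set (Language α) :=
  {L | ∃ V : Verifier α, V.Verifies {P | P.IsOneWay} L}

/-! ### Multihead automata -/

/-- A nondeterministic finite automaton with `k` heads on a read-only tape. An element `(q', d)` of a value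
of the transition function says: go to state `q'` and move the head `i` by `d i`, for each `i`. -/
structure MultiheadNFA (α : Type) (k : ℕ) where
  Q : Type
  finite_Q : Finite Q
  start : Q
  accept : Set Q
  next : Q → (Fin k → Option α) → Set (Q × (Fin k → SignType))

namespace MultiheadNFA

variable {α : Type} {k : ℕ} (M : MultiheadNFA α k)

/-- One step on input `x`, between configurations (a state and the head positions). No head may move
beyond the end-markers. -/
def Step (x : List α) (c c' : M.Q × (Fin k → ℤ)) : Prop :=
  ∃ d : Fin k → SignType, (c'.1, d) ∈ M.next c.1 (fun i => tapeSymbol x (c.2 i)) ∧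
    ∀ i, c'.2 i = c.2 i + (d i : ℤ) ∧ OnTape x (c'.2 i)

/-- The language of the automaton: it starts with all heads on the left end-marker, and accepts if some
computation reaches an accepting state. -/
def language : Language α :=
  {x | ∃ c, Relation.ReflTransGen (M.Step x) (M.start, fun _ => 0) c ∧ c.1 ∈ M.accept}

/-- No head is allowed to move left. -/
def OneWay : Prop :=
  ∀ q σ q' d, (q', d) ∈ M.next q σ → ∀ i, d i ≠ -1

end MultiheadNFA

/-- The class `1NFA(k)` over the alphabet `α`. -/
def OneWayNFA (α : Type) (k : ℕ) : Set (Language α) :=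
  {L | ∃ M : MultiheadNFA α k, M.OneWay ∧ M.language = L}

/-! From verifiers to automata. With at most `r` coins only `2 ^ r` coin sequences matter, and in
bounded space everything in a run except the input head and the history takes finitely many values.
So an automaton with one head per coin sequence can run all of them against one guessed prover: it
guesses a set of sequences of probability above `1 / 2` and verifies acceptance on it. Histories are
unbounded, but it is enough to remember which runs still look alike to the prover, since exactly
these must get equal answers; this is a finite relation, updated when all guessed runs communicate
at once. As `ε < 1 / 2`, such a set exists for `x ∈ L`, while for `x ∉ L` it would be disjoint from
a rejection event of probability above `1 / 2`. `exists_prover_of_simulator` and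
`exists_simulator_computation` are the two directions; `IsCoherent` covers both classes of provers.

From automata to verifiers. For each transition that moves some head, the prover sends the symbols
scanned by all heads and the transition. The verifier secretly picks one head and compares only its
symbol with the tape. It always writes the same symbol, so the prover never learns the choice, and
an honest prover can be one-way. If no choice of head forces rejection, then all claims are true and
describe a genuine computation; every message moves a head to the right, so it cannot go on forever
and must accept. Hence for `x ∉ L` some head rejects (`exists_rejecting_head`). This may have small
probability, so the verifier also rejects outright with probability just below `1 / 2`, which brings
both errors below `1 / 2` (`exists_head_choice`). -/

/-! ### Two classes of provers, by what they observe -/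

/-- A class `S` of provers whose answers are determined by what they are able to observe: `τ` relates
verifier symbols, and `E` relates communication histories, that look the same to them; and whose
answers can otherwise be prescribed freely. -/
structure IsCoherent {α Γ : Type} (S : Set (Prover α Γ)) (τ : Γ → Γ → Prop)
    (E : List (Γ × Γ) → List (Γ × Γ) → Prop) : Prop where
  nil : E [] []
  cons : ∀ {h h' g g'} (a : Γ), E h h' → τ g g' → E ((g, a) :: h) ((g', a) :: h')
  of_cons : ∀ {h h' g g' a a'}, E ((g, a) :: h) ((g', a') :: h') → E h h' ∧ τ g g'
  answer : ∀ {P}, P ∈ S → ∀ {x h h' g g'}, E h h' → τ g g' → P x h g = P x h' g'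
  extend : ∀ {P}, P ∈ S → ∀ (x : List α) (n : ℕ) {ι : Type} (h : ι → List (Γ × Γ)) (g a : ι → Γ),
    (∀ i, (h i).length = n) → (∀ i j, E (h i) (h j) → τ (g i) (g j) → a i = a j) →
    ∃ P' ∈ S, (∀ h' g', h'.length < n → P' x h' g' = P x h' g') ∧ ∀ i, P' x (h i) (g i) = a i

/-- An unrestricted prover observes everything, and a function may be redefined on any set of
arguments. -/
theorem isCoherent_univ (α Γ : Type) :
    IsCoherent (Set.univ : Set (Prover α Γ)) (· = ·) (· = ·) where
  nil := rfl
  cons := by rintro h _ g _ a rfl rfl; rfl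
  of_cons := by
    intro h h' g g' a a' e
    simp only [List.cons.injEq, Prod.mk.injEq] at e
    exact ⟨e.2, e.1.1⟩
  answer := by rintro P - x h _ g _ rfl rfl; rfl
  extend := by
    classical
    intro P _ x n ι h g a hn hc
    refine ⟨fun y h' g' => if w : ∃ i, h i = h' ∧ g i = g' then a w.choose else P y h' g',
      trivial, ?_, ?_⟩
    · intro h' g' hl
      apply dif_neg
      rintro ⟨i, rfl, -⟩
      exact absurd (hn i) hl.ne
    · intro i
      have w : ∃ j, h j = h i ∧ g j = g i := ⟨i, rfl, rfl⟩
      exact (dif_pos w).trans (hc _ _ w.choose_spec.1 w.choose_spec.2)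

/-- A one-way prover observes only the number of the step. Answers prescribed at length `n` are
therefore all equal, and changing one term of its sequence suffices. -/
theorem isCoherent_oneWay (α Γ : Type) :
    IsCoherent {P : Prover α Γ | P.IsOneWay} (fun _ _ => True) (fun h h' => h.length = h'.length) where
  nil := rfl
  cons := by intro h h' g g' a e _; simpa using e
  of_cons := by intro h h' g g' a a' e; simpa using e
  answer := by
    rintro P ⟨c, hc⟩ x h h' g g' e -
    rw [hc, hc, e]
  extend := by
    rintro P ⟨c, hc⟩ x n ι h g a hn hcon
    rcases isEmpty_or_nonempty ι with _ | ⟨⟨i₀⟩⟩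
    · exact ⟨P, ⟨c, hc⟩, fun _ _ _ => rfl, fun i => isEmptyElim i⟩
    · refine ⟨fun y h' g' => if h'.length = n then a i₀ else P y h' g',
        ⟨fun y m => if m = n then a i₀ else c y m, ?_⟩, ?_, ?_⟩
      · intro y h' g'
        simp only [hc]
      · intro h' g' hl
        exact if_neg hl.ne
      · intro i
        exact (if_pos (hn i)).trans (hcon _ _ ((hn i₀).trans (hn i).symm) trivial)

/-! ### Runs of a verifier: finite memory, dependence on prover and coins -/

instance {R D : Type} [Finite R] [Finite D] : Finite (VState R D) := by
  refine Finite.of_injective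
    (fun s : VState R D => (match s with
      | .run q => some (some q)
      | .accept => some none
      | .reject => none : Option (Option (R ⊕ D)))) ?_
  intro a b
  cases a <;> cases b <;> simp

namespace Verifier

variable {α : Type} (V : Verifier α)

/-- The symbol that the verifier writes in a state; the null symbol after halting. -/
def symOf : VState V.R V.D → V.Γ
  | .run q => V.sym q
  | .accept => V.null
  | .reject => V.null

/-- A snapshot without the input head and the history. -/
@[ext] structure Memory where
  state : VState V.R V.D
  work : ℤ → V.Θ
  workHead : ℤ
  coins : ℕ

variable {V}

def Snapshot.memory (c : V.Snapshot) : V.Memory := ⟨c.state, c.work, c.workHead, c.coins⟩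

/-- One step of the memory, given the scanned input symbol and the prover's symbol, with the movement
of the input head. -/
def Memory.step (ω : ℕ → Bool) (σ : Option α) (γ : V.Γ) (m : V.Memory) : V.Memory × SignType :=
  match m.state with
  | .run (.inl q) =>
      let a := V.tossStep q σ (m.work m.workHead) γ (ω m.coins)
      (⟨a.1, Function.update m.work m.workHead a.2.1, m.workHead + (a.2.2.2 : ℤ), m.coins + 1⟩,
        a.2.2.1)
  | .run (.inr q) =>
      let a := V.detStep q σ (m.work m.workHead) γ
      (⟨a.1, Function.update m.work m.workHead a.2.1, m.workHead + (a.2.2.2 : ℤ), m.coins⟩,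
        a.2.2.1)
  | .accept => (m, 0)
  | .reject => (m, 0)

/-- The work tape is only used between the cells `-s` and `s`, and at most `r` coins were tossed. -/
def Memory.Bounded (s r : ℕ) (m : V.Memory) : Prop :=
  m.coins ≤ r ∧ m.workHead ∈ Set.Icc (-s : ℤ) s ∧ ∀ i ∉ Set.Icc (-s : ℤ) s, m.work i = V.blank

/-- This is what makes the simulator below a finite automaton. -/
instance (s r : ℕ) : Finite {m : V.Memory // m.Bounded s r} := by
  have := V.finite_R
  have := V.finite_D
  have := V.finite_Θ
  refine Finite.of_injective
    (fun m : {m : V.Memory // m.Bounded s r} =>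
      ((m.1.state, fun i : Set.Icc (-s : ℤ) s => m.1.work i,
        (⟨m.1.workHead, m.2.2.1⟩ : Set.Icc (-s : ℤ) s),
        (⟨m.1.coins, Nat.lt_succ_of_le m.2.1⟩ : Fin (r + 1))) :
        VState V.R V.D × (Set.Icc (-s : ℤ) s → V.Θ) × Set.Icc (-s : ℤ) s × Fin (r + 1))) ?_
  rintro ⟨m, hm⟩ ⟨m', hm'⟩ e
  simp only [Prod.mk.injEq, Subtype.mk.injEq, Fin.mk.injEq] at e
  obtain ⟨e1, e2, e3, e4⟩ := e
  refine Subtype.ext (Memory.ext e1 (funext fun i => ?_) e3 e4)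
  by_cases hi : i ∈ Set.Icc (-s : ℤ) s
  · exact congrFun e2 ⟨i, hi⟩
  · exact (hm.2.2 i hi).trans (hm'.2.2 i hi).symm

open Classical in
/-- The prover's symbol in the next step. -/
noncomputable def received (P : Prover α V.Γ) (x : List α) (c : V.Snapshot) : V.Γ :=
  if V.symOf c.state = V.null then V.null else P x c.history (V.symOf c.state)

theorem received_of_eq_null {P : Prover α V.Γ} {x : List α} {c : V.Snapshot}
    (h : V.symOf c.state = V.null) : received P x c = V.null := if_pos h

theorem received_of_ne_null {P : Prover α V.Γ} {x : List α} {c : V.Snapshot}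
    (h : V.symOf c.state ≠ V.null) : received P x c = P x c.history (V.symOf c.state) := if_neg h

variable (P : Prover α V.Γ) (x : List α) (ω : ℕ → Bool) (c : V.Snapshot)

theorem memory_step : (V.step P x ω c).memory =
    (c.memory.step ω (tapeSymbol x c.inputHead) (received P x c)).1 := by
  obtain ⟨⟨s, p, w, wh⟩, h, n⟩ := c
  rcases s with (q | q) | _ | _
  · by_cases e : V.sym (.inl q) = V.null <;>
      simp [step, Snapshot.memory, Memory.step, perform, exchange, received, symOf, e]
  · by_cases e : V.sym (.inr q) = V.null <;>
      simp [step, Snapshot.memory, Memory.step, perform, exchange, received, symOf, e]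
  · rfl
  · rfl

theorem inputHead_step : (V.step P x ω c).inputHead = c.inputHead +
    ((c.memory.step ω (tapeSymbol x c.inputHead) (received P x c)).2 : ℤ) := by
  obtain ⟨⟨s, p, w, wh⟩, h, n⟩ := c
  rcases s with (q | q) | _ | _
  · by_cases e : V.sym (.inl q) = V.null <;>
      simp [step, Snapshot.memory, Memory.step, perform, exchange, received, symOf, e]
  · by_cases e : V.sym (.inr q) = V.null <;>
      simp [step, Snapshot.memory, Memory.step, perform, exchange, received, symOf, e]
  · simp [step, Snapshot.memory, Memory.step]
  · simp [step, Snapshot.memory, Memory.step]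

variable {P x ω c}

theorem history_step_of_eq_null (e : V.symOf c.state = V.null) :
    (V.step P x ω c).history = c.history := by
  obtain ⟨⟨s, p, w, wh⟩, h, n⟩ := c
  rcases s with (q | q) | _ | _ <;> simp only [symOf] at e <;>
    simp [step, perform, exchange, e]

theorem history_step_of_ne_null (e : V.symOf c.state ≠ V.null) :
    (V.step P x ω c).history =
      (V.symOf c.state, P x c.history (V.symOf c.state)) :: c.history := by
  obtain ⟨⟨s, p, w, wh⟩, h, n⟩ := c
  rcases s with (q | q) | _ | _ <;> simp only [symOf] at e <;>
    simp_all [step, perform, exchange, symOf]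

theorem length_history_le_step : c.history.length ≤ (V.step P x ω c).history.length := by
  by_cases e : V.symOf c.state = V.null
  · rw [history_step_of_eq_null e]
  · rw [history_step_of_ne_null e]; simp

theorem step_eq_self (hc : ¬ ∃ q, c.state = .run q) : V.step P x ω c = c := by
  obtain ⟨⟨s, p, w, wh⟩, h, n⟩ := c
  rcases s with q | _ | _
  · exact absurd ⟨q, rfl⟩ hc
  · rfl
  · rfl

theorem step_congr_prover {P' : Prover α V.Γ}
    (h : V.symOf c.state ≠ V.null →
      P' x c.history (V.symOf c.state) = P x c.history (V.symOf c.state)) :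
    V.step P' x ω c = V.step P x ω c := by
  obtain ⟨⟨s, p, w, wh⟩, hi, n⟩ := c
  rcases s with (q | q) | _ | _
  · by_cases e : V.sym (.inl q) = V.null <;> simp_all [step, exchange, symOf]
  · by_cases e : V.sym (.inr q) = V.null <;> simp_all [step, exchange, symOf]
  · rfl
  · rfl

theorem after_succ (t : ℕ) : V.after P x ω (t + 1) = V.step P x ω (V.after P x ω t) :=
  Function.iterate_succ_apply' _ _ _

/-- A run with at most `n` exchanges has used only answers to histories shorter than `n`, so answers
at length `n` can be fixed later without disturbing it. -/
theorem after_congr_prover {P' : Prover α V.Γ} {n : ℕ}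
    (h : ∀ h' g', h'.length < n → P' x h' g' = P x h' g') (t : ℕ)
    (ht : (V.after P x ω t).history.length ≤ n) : V.after P' x ω t = V.after P x ω t := by
  induction t with
  | zero => rfl
  | succ t ih =>
    rw [after_succ] at ht
    rw [after_succ, after_succ, ih (length_history_le_step.trans ht)]
    refine step_congr_prover fun e => h _ _ ?_
    rw [history_step_of_ne_null e] at ht
    simpa using ht

/-- The bound on the coins also holds after each toss, so every bit that is read has an index below
`r`. -/
theorem after_congr_coins {ω' : ℕ → Bool} {r : ℕ} (h : ∀ n < r, ω' n = ω n)
    (hr : ∀ t, (V.after P x ω t).coins ≤ r) (t : ℕ) : V.after P x ω' t = V.after P x ω t := by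
  induction t with
  | zero => rfl
  | succ t ih =>
    rw [after_succ, after_succ, ih]
    have := hr (t + 1)
    rw [after_succ] at this
    generalize V.after P x ω t = c at this ⊢
    obtain ⟨⟨s, p, w, wh⟩, hi, n⟩ := c
    rcases s with (q | q) | _ | _
    · have hn : n < r := this
      simp [step, h n hn]
    · rfl
    · rfl
    · rfl

theorem after_eq_of_halted {t t' : ℕ} (htt : t ≤ t') (hc : ¬ ∃ q, (V.after P x ω t).state = .run q) :
    V.after P x ω t' = V.after P x ω t := by
  induction t', htt using Nat.le_induction with
  | base => rfl
  | succ n _ ih => rw [after_succ, ih, step_eq_self hc]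

theorem workHead_step_natAbs : (V.step P x ω c).workHead.natAbs ≤ c.workHead.natAbs + 1 := by
  have key : ∀ (a : ℤ) (d : SignType), (a + (d : ℤ)).natAbs ≤ a.natAbs + 1 := by
    intro a d
    cases d
    · change (a + 0).natAbs ≤ _
      omega
    · change (a + -1).natAbs ≤ _
      omega
    · change (a + 1).natAbs ≤ _
      omega
  obtain ⟨⟨s, p, w, wh⟩, h, n⟩ := c
  rcases s with (q | q) | _ | _
  · exact key _ _
  · exact key _ _
  · exact Nat.le_succ _
  · exact Nat.le_succ _

/-- The head moves by at most one cell per step, so every distance from cell `0` up to the present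
one has been attained; these are at most `s` values, including `0`. -/
theorem natAbs_workHead_lt {s : ℕ}
    (hs : (Set.range fun t => (V.after P x ω t).workHead).encard ≤ s) (t : ℕ) :
    (V.after P x ω t).workHead.natAbs < s := by
  have cover : ∀ t, ∀ n ≤ (V.after P x ω t).workHead.natAbs,
      ∃ t', (V.after P x ω t').workHead.natAbs = n := by
    intro t
    induction t with
    | zero =>
      intro n hn
      have : n = 0 := Nat.le_zero.1 hn
      subst this
      exact ⟨0, rfl⟩
    | succ t ih =>
      intro n hn
      by_cases h : n ≤ (V.after P x ω t).workHead.natAbs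
      · exact ih n h
      · refine ⟨t + 1, ?_⟩
        have := workHead_step_natAbs (P := P) (x := x) (ω := ω) (c := V.after P x ω t)
        rw [← after_succ] at this
        omega
  have h1 : (Set.Iic (V.after P x ω t).workHead.natAbs) ⊆
      Int.natAbs '' (Set.range fun t => (V.after P x ω t).workHead) := by
    intro n hn
    obtain ⟨t', ht'⟩ := cover t n hn
    exact ⟨_, ⟨t', rfl⟩, ht'⟩
  have h2 := (Set.encard_le_encard h1).trans ((Set.encard_image_le _ _).trans hs)
  rw [← Finset.coe_Iic, Set.encard_coe_eq_coe_finsetCard, Nat.card_Iic] at h2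
  exact_mod_cast h2

theorem work_eq_blank {s : ℕ} (hs : ∀ t, (V.after P x ω t).workHead ∈ Set.Icc (-s : ℤ) s) (t : ℕ) :
    ∀ i ∉ Set.Icc (-s : ℤ) s, (V.after P x ω t).work i = V.blank := by
  intro i hi
  induction t with
  | zero => rfl
  | succ t ih =>
    have hne : i ≠ (V.after P x ω t).workHead := fun e => hi (e ▸ hs t)
    rw [after_succ]
    generalize V.after P x ω t = c at ih hne ⊢
    obtain ⟨⟨s, p, w, wh⟩, h, n⟩ := c
    rcases s with (q | q) | _ | _
    · exact (Function.update_of_ne hne _ _).trans ih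
    · exact (Function.update_of_ne hne _ _).trans ih
    · exact ih
    · exact ih

theorem bounded_memory_after {s r : ℕ}
    (hs : (Set.range fun t => (V.after P x ω t).workHead).encard ≤ s)
    (hr : ∀ t, (V.after P x ω t).coins ≤ r) (t : ℕ) : (V.after P x ω t).memory.Bounded s r := by
  have h : ∀ t, (V.after P x ω t).workHead ∈ Set.Icc (-s : ℤ) s := by
    intro t
    have := natAbs_workHead_lt hs t
    constructor <;> omega
  exact ⟨hr t, h t, work_eq_blank h t⟩

theorem bounded_memory_init (s r : ℕ) : V.init.memory.Bounded s r :=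
  ⟨Nat.zero_le _, by simp [Snapshot.memory, init], fun _ _ => rfl⟩

theorem Memory.step_snd_ne (hV : V.OneWayInput) (σ : Option α) (γ : V.Γ) (m : V.Memory) :
    (m.step ω σ γ).2 ≠ -1 := by
  obtain ⟨s, w, wh, n⟩ := m
  rcases s with (q | q) | _ | _
  · exact hV.1 _ _ _ _ _
  · exact hV.2 _ _ _ _
  · simp [Memory.step]
  · simp [Memory.step]

end Verifier

/-! ### Simulation of a verifier by a multihead automaton -/

namespace Verifier

variable {α : Type}

/-- The automaton that runs the verifier for all coin sequences `bits i` at once, with one head for each.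
It guesses a set from `heavy`, of indices of sequences for which the verifier accepts, and the answers of
the prover. All runs in this set communicate at the same time. The last component of a state relates
those runs that are indistinguishable to the prover so far. -/
def simulator (V : Verifier α) (τ : V.Γ → V.Γ → Prop) (s r : ℕ) {k : ℕ} (bits : Fin k → ℕ → Bool)
    (heavy : Set (Set (Fin k))) : MultiheadNFA α k where
  Q := Option (Set (Fin k) × (Fin k → {m : V.Memory // m.Bounded s r}) × (Fin k → Fin k → Prop))
  finite_Q := inferInstance
  start := none
  accept := {q | ∃ K m same, q = some (K, m, same) ∧ ∀ i ∈ K, (m i).1.state = .accept}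
  next q σ := {p | match q with
    | none => ∃ K same, K ∈ heavy ∧ (∀ i j, same i j) ∧
        p = (some (K, fun _ => ⟨_, V.bounded_memory_init s r⟩, same), fun _ => 0)
    | some (K, m, same) => ∃ (A : Set (Fin k)) (a : Fin k → V.Γ) (m' : _) (same' : _),
        p.1 = some (K, m', same') ∧
        (∀ i ∈ A, (((m' i).1, p.2 i) : V.Memory × SignType) =
          (m i).1.step (bits i) (σ i) (a i)) ∧
        (∀ i ∉ A, m' i = m i ∧ p.2 i = 0) ∧
        -- Either silent moves of any runs, or one exchange of all runs in `K`, where halted ones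
        -- idle. `same'` is bounded only from below in an exchange: a relation that is too large
        -- merely forces more answers to agree.
        (((∀ i ∈ A, V.symOf (m i).1.state = V.null ∧ a i = V.null) ∧ same' = same) ∨
          (A = K ∧ (∀ i ∈ K, (∃ q, (m i).1.state = .run q) → V.symOf (m i).1.state ≠ V.null) ∧
            ∀ i ∈ K, ∀ j ∈ K, (∃ q, (m i).1.state = .run q) → (∃ q, (m j).1.state = .run q) →
              same i j → τ (V.symOf (m i).1.state) (V.symOf (m j).1.state) →
                a i = a j ∧ same' i j))}

variable {V : Verifier α} {τ : V.Γ → V.Γ → Prop} {s r k : ℕ} {bits : Fin k → ℕ → Bool}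
  {heavy : Set (Set (Fin k))}

theorem simulator_oneWay (hV : V.OneWayInput) : (V.simulator τ s r bits heavy).OneWay := by
  intro q σ q' d h i
  rcases q with _ | ⟨K, m, same⟩
  · obtain ⟨K, same, -, -, e⟩ := h
    rw [(Prod.mk.inj e).2]
    simp
  · obtain ⟨A, a, m', same', -, h1, h2, -⟩ := h
    by_cases hi : i ∈ A
    · exact (Prod.mk.inj (h1 i hi)).2.trans_ne (Memory.step_snd_ne hV _ _ _)
    · exact (h2 i hi).2.trans_ne (by decide)

variable {S : Set (Prover α V.Γ)} {E : List (V.Γ × V.Γ) → List (V.Γ × V.Γ) → Prop}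

/-- Every computation of the simulator comes from runs of the verifier against a single prover. -/
theorem exists_prover_of_simulator (hS : IsCoherent S τ E) (hne : S.Nonempty) (x : List α)
    {c : (V.simulator τ s r bits heavy).Q × (Fin k → ℤ)}
    (h : Relation.ReflTransGen ((V.simulator τ s r bits heavy).Step x)
      ((V.simulator τ s r bits heavy).start, fun _ => 0) c) :
    (c = ((V.simulator τ s r bits heavy).start, fun _ => 0)) ∨
    ∃ K m same, c.1 = some (K, m, same) ∧ K ∈ heavy ∧ ∃ P ∈ S, ∃ (n : ℕ) (T : Fin k → ℕ),
      (∀ i ∈ K, (V.after P x (bits i) (T i)).memory = (m i).1 ∧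
        (V.after P x (bits i) (T i)).inputHead = c.2 i ∧
        (V.after P x (bits i) (T i)).history.length ≤ n ∧
        ((∃ q, (V.after P x (bits i) (T i)).state = .run q) →
          (V.after P x (bits i) (T i)).history.length = n)) ∧
      ∀ i ∈ K, ∀ j ∈ K, (∃ q, (V.after P x (bits i) (T i)).state = .run q) →
        (∃ q, (V.after P x (bits j) (T j)).state = .run q) →
        E (V.after P x (bits i) (T i)).history (V.after P x (bits j) (T j)).history → same i j := by
  classical
  induction h with
  | refl => exact .inl rfl
  | @tail c c' _ hstep ih =>
    right
    obtain ⟨P₀, hP₀⟩ := hne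
    obtain ⟨d, hnext, hpos⟩ := hstep
    rcases ih with rfl | ⟨K, m, same, hc, hK, P, hP, n, T, hrun, hsame⟩
    · obtain ⟨K, same, hK, hs, e⟩ := hnext
      obtain ⟨e1, e2⟩ := Prod.mk.inj e
      refine ⟨K, _, same, e1, hK, P₀, hP₀, 0, fun _ => 0, fun i _ => ⟨rfl, ?_, le_rfl, fun _ => rfl⟩,
        fun i _ j _ _ _ _ => hs i j⟩
      rw [(hpos i).1, e2]
      rfl
    rw [hc] at hnext
    obtain ⟨A, a, m', same', e, hA, hA', hcase⟩ := hnext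
    have hstate : ∀ i ∈ K, (m i).1.state = (V.after P x (bits i) (T i)).state := by
      intro i hi
      rw [← (hrun i hi).1]
      rfl
    rcases hcase with ⟨hnull, rfl⟩ | ⟨rfl, htalk, hcons⟩
    · have hhist : ∀ i ∈ K, (V.after P x (bits i) (if i ∈ A then T i + 1 else T i)).history =
          (V.after P x (bits i) (T i)).history := by
        intro i hi
        split_ifs with hiA
        · rw [after_succ, history_step_of_eq_null]
          rw [← hstate i hi]
          exact (hnull i hiA).1
        · rfl
      have hrunning : ∀ i ∈ K,
          (∃ q, (V.after P x (bits i) (if i ∈ A then T i + 1 else T i)).state = .run q) →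
          ∃ q, (V.after P x (bits i) (T i)).state = .run q := by
        intro i hi hq
        by_contra hn
        rw [after_eq_of_halted (by split_ifs <;> omega) hn] at hq
        exact hn hq
      refine ⟨K, m', same', e, hK, P, hP, n, fun i => if i ∈ A then T i + 1 else T i, ?_, ?_⟩
      · intro i hi
        beta_reduce
        obtain ⟨h1, h2, h3, h4⟩ := hrun i hi
        rw [hhist i hi]
        refine ⟨?_, ?_, h3, fun hq => h4 (hrunning i hi hq)⟩
        · split_ifs with hiA
          · rw [after_succ, memory_step, received_of_eq_null, h1, h2, ← (hnull i hiA).2,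
              ← hA i hiA]
            rw [← hstate i hi]
            exact (hnull i hiA).1
          · rw [(hA' i hiA).1, h1]
        · split_ifs with hiA
          · rw [after_succ, inputHead_step, received_of_eq_null, h1, h2, ← (hnull i hiA).2,
              ← hA i hiA, (hpos i).1]
            rw [← hstate i hi]
            exact (hnull i hiA).1
          · rw [h2, (hpos i).1, show d i = 0 from (hA' i hiA).2]
            simp
      · intro i hi j hj qi qj hE
        beta_reduce at qi qj hE
        rw [hhist i hi, hhist j hj] at hE
        exact hsame i hi j hj (hrunning i hi qi) (hrunning j hj qj) hE
    -- All running members of the guessed set have histories of length `n`, so their next answers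
    -- can be prescribed together at this length. Halted members ask nothing and are left out.
    · let ι := {i : Fin k // i ∈ A ∧ ∃ q, (V.after P x (bits i) (T i)).state = .run q}
      obtain ⟨P', hP', hlt, hans⟩ := hS.extend hP x n (ι := ι)
        (fun i => (V.after P x (bits i.1) (T i.1)).history) (fun i => V.symOf (m i.1).1.state)
        (fun i => a i.1) (fun i => (hrun i.1 i.2.1).2.2.2 i.2.2) (by
          rintro ⟨i, hi, qi⟩ ⟨j, hj, qj⟩ hE hτ
          exact (hcons i hi j hj (by rwa [hstate i hi]) (by rwa [hstate j hj])
            (hsame i hi j hj qi qj hE) hτ).1)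
      have hafter : ∀ i ∈ A, V.after P' x (bits i) (T i) = V.after P x (bits i) (T i) :=
        fun i hi => after_congr_prover hlt _ (hrun i hi).2.2.1
      have hrunning : ∀ i ∈ A, (∃ q, (V.after P' x (bits i) (T i + 1)).state = .run q) →
          ∃ q, (V.after P x (bits i) (T i)).state = .run q := by
        intro i hi hq
        by_contra hn
        rw [← hafter i hi] at hn
        rw [after_eq_of_halted (Nat.le_succ _) hn] at hq
        exact hn hq
      have htalk' : ∀ i ∈ A, (∃ q, (V.after P x (bits i) (T i)).state = .run q) →
          V.symOf (V.after P x (bits i) (T i)).state ≠ V.null := by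
        intro i hi hq
        rw [← hstate i hi] at hq ⊢
        exact htalk i hi hq
      have hhist : ∀ i ∈ A, (∃ q, (V.after P x (bits i) (T i)).state = .run q) →
          (V.after P' x (bits i) (T i + 1)).history =
            (V.symOf (m i).1.state, a i) :: (V.after P x (bits i) (T i)).history := by
        intro i hi hq
        rw [after_succ, hafter i hi, history_step_of_ne_null (htalk' i hi hq), ← hstate i hi]
        congr 2
        exact hans ⟨i, hi, hq⟩
      refine ⟨A, m', same', e, hK, P', hP', n + 1, fun i => T i + 1, ?_, ?_⟩
      · intro i hi
        beta_reduce
        obtain ⟨h1, h2, h3, h4⟩ := hrun i hi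
        by_cases hq : ∃ q, (V.after P x (bits i) (T i)).state = .run q
        · have hrec : received P' x (V.after P x (bits i) (T i)) = a i := by
            rw [received_of_ne_null (htalk' i hi hq), ← hstate i hi]
            exact hans ⟨i, hi, hq⟩
          refine ⟨?_, ?_, ?_, fun _ => ?_⟩
          · rw [after_succ, hafter i hi, memory_step, hrec, h1, h2, ← hA i hi]
          · rw [after_succ, hafter i hi, inputHead_step, hrec, h1, h2, ← hA i hi, (hpos i).1]
          · rw [hhist i hi hq, List.length_cons, h4 hq]
          · rw [hhist i hi hq, List.length_cons, h4 hq]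
        -- A halted run ignores its guessed symbol, and its history stays short; this is why the
        -- invariant demands length exactly `n` only of running ones.
        · have hst : ¬ ∃ q, (m i).1.state = .run q := by rwa [hstate i hi]
          have hmem : (m i).1.step (bits i) (tapeSymbol x (c.2 i)) (a i) = ((m i).1, 0) := by
            generalize (m i).1 = m₀ at hst
            obtain ⟨s₀, w, wh, n₀⟩ := m₀
            rcases s₀ with q | _ | _
            · exact absurd ⟨q, rfl⟩ hst
            · rfl
            · rfl
          have h5 := hA i hi
          rw [hmem] at h5
          obtain ⟨h6, h7⟩ := Prod.mk.inj h5
          have h8 : V.after P' x (bits i) (T i + 1) = V.after P x (bits i) (T i) := by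
            rw [after_succ, hafter i hi, step_eq_self hq]
          rw [h8]
          refine ⟨h1.trans h6.symm, ?_, h3.trans (Nat.le_succ n), fun h => absurd h hq⟩
          rw [h2, (hpos i).1, show d i = 0 from h7]
          simp
      · intro i hi j hj qi qj hE
        have qi' := hrunning i hi qi
        have qj' := hrunning j hj qj
        beta_reduce at hE
        rw [hhist i hi qi', hhist j hj qj'] at hE
        obtain ⟨hE1, hE2⟩ := hS.of_cons hE
        exact (hcons i hi j hj (by rwa [hstate i hi]) (by rwa [hstate j hj])
          (hsame i hi j hj qi' qj' hE1) hE2).2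

/-- The configuration of the simulator in which the run of index `i` has reached time `T i`. -/
noncomputable def simConfig (P : Prover α V.Γ) (x : List α) (bits : Fin k → ℕ → Bool)
    (E : List (V.Γ × V.Γ) → List (V.Γ × V.Γ) → Prop)
    (hb : ∀ i t, (V.after P x (bits i) t).memory.Bounded s r) (K : Set (Fin k)) (T : Fin k → ℕ) :
    (V.simulator τ s r bits heavy).Q × (Fin k → ℤ) :=
  (some (K, fun i => ⟨_, hb i (T i)⟩,
    fun i j => E (V.after P x (bits i) (T i)).history (V.after P x (bits j) (T j)).history),
    fun i => (V.after P x (bits i) (T i)).inputHead)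

/-- The schedule: a running member of `K` that is about to step silently moves alone; when there is
none, all of `K` exchange symbols together. The guesses are the answers of `P` and `same` is `E`
itself, so coherence gives the agreement that the automaton checks. -/
theorem exists_simulator_computation (hS : IsCoherent S τ E) {P : Prover α V.Γ} (hP : P ∈ S)
    (x : List α) (hb : ∀ i t, (V.after P x (bits i) t).memory.Bounded s r)
    (htape : ∀ ω t, OnTape x (V.after P x ω t).inputHead) {K : Set (Fin k)}
    {N : ℕ} (hN : ∀ i ∈ K, (V.after P x (bits i) N).state = .accept) (T : Fin k → ℕ) :
    ∃ T' : Fin k → ℕ, Relation.ReflTransGen ((V.simulator τ s r bits heavy).Step x)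
      (simConfig P x bits E hb K T) (simConfig P x bits E hb K T') ∧
      ∀ i ∈ K, (V.after P x (bits i) (T' i)).state = .accept := by
  classical
  have hlt : ∀ (T : Fin k → ℕ), ∀ i ∈ K, (∃ q, (V.after P x (bits i) (T i)).state = .run q) →
      T i < N := by
    rintro T i hi ⟨q, hq⟩
    by_contra hle
    have := after_eq_of_halted (P := P) (x := x) (not_lt.1 hle)
      (by rw [hN i hi]; simp)
    rw [this, hN i hi] at hq
    cases hq
  -- The total time that the runs in `K` have left before `N` drops with each move.
  induction h : ∑ i, (if i ∈ K then N - T i else 0) using Nat.strong_induction_on generalizing T with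
  | _ D ih =>
  subst h
  by_cases hall : ∀ i ∈ K, ¬ ∃ q, (V.after P x (bits i) (T i)).state = .run q
  · refine ⟨T, .refl, fun i hi => ?_⟩
    rcases le_total (T i) N with hle | hle
    · rw [← after_eq_of_halted hle (hall i hi)]
      exact hN i hi
    · rw [after_eq_of_halted hle (by rw [hN i hi]; simp)]
      exact hN i hi
  push Not at hall
  obtain ⟨i₀, hi₀, hq₀⟩ := hall
  have main : ∀ A : Set (Fin k), ((∀ i ∈ A, V.symOf (V.after P x (bits i) (T i)).state = V.null) ∨
      A = K ∧ ∀ i ∈ K, (∃ q, (V.after P x (bits i) (T i)).state = .run q) →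
        V.symOf (V.after P x (bits i) (T i)).state ≠ V.null) →
      (∃ i ∈ K, i ∈ A ∧ ∃ q, (V.after P x (bits i) (T i)).state = .run q) →
      ∃ T' : Fin k → ℕ, Relation.ReflTransGen ((V.simulator τ s r bits heavy).Step x)
        (simConfig P x bits E hb K T) (simConfig P x bits E hb K T') ∧
        ∀ i ∈ K, (V.after P x (bits i) (T' i)).state = .accept := by
    rintro A hA ⟨i₁, hi₁K, hi₁A, hq₁⟩
    let T₁ : Fin k → ℕ := fun i => if i ∈ A then T i + 1 else T i
    have hT₁ : ∀ i ∈ A, T₁ i = T i + 1 := fun i hi => if_pos hi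
    have hT₁' : ∀ i ∉ A, T₁ i = T i := fun i hi => if_neg hi
    have hdec : ∑ i, (if i ∈ K then N - T₁ i else 0) < ∑ i, (if i ∈ K then N - T i else 0) := by
      apply Finset.sum_lt_sum
      · intro i _
        by_cases hi : i ∈ A
        · rw [hT₁ i hi]
          split_ifs <;> omega
        · rw [hT₁' i hi]
      · refine ⟨i₁, Finset.mem_univ _, ?_⟩
        rw [if_pos hi₁K, if_pos hi₁K, hT₁ i₁ hi₁A]
        have := hlt T i₁ hi₁K hq₁
        omega
    obtain ⟨T', hT', hacc⟩ := ih _ hdec T₁ rfl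
    refine ⟨T', Relation.ReflTransGen.head ?_ hT', hacc⟩
    refine ⟨fun i => if i ∈ A then ((V.after P x (bits i) (T i)).memory.step (bits i)
      (tapeSymbol x (V.after P x (bits i) (T i)).inputHead)
      (received P x (V.after P x (bits i) (T i)))).2 else 0, ?_, fun i => ⟨?_, htape _ _⟩⟩
    · refine ⟨A, fun i => received P x (V.after P x (bits i) (T i)), _, _, rfl, ?_, ?_, ?_⟩
      · intro i hi
        refine Prod.ext ?_ (if_pos hi)
        change (V.after P x (bits i) (T₁ i)).memory = _
        rw [hT₁ i hi, after_succ, memory_step]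
        rfl
      · intro i hi
        refine ⟨Subtype.ext ?_, if_neg hi⟩
        change (V.after P x (bits i) (T₁ i)).memory = _
        rw [hT₁' i hi]
      · rcases hA with hA | ⟨rfl, hA⟩
        · refine .inl ⟨fun i hi => ⟨hA i hi, received_of_eq_null (hA i hi)⟩, ?_⟩
          have hh : ∀ i, (V.after P x (bits i) (T₁ i)).history =
              (V.after P x (bits i) (T i)).history := by
            intro i
            by_cases hi : i ∈ A
            · rw [hT₁ i hi, after_succ, history_step_of_eq_null (hA i hi)]
            · rw [hT₁' i hi]
          funext i j
          rw [hh, hh]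
        · refine .inr ⟨rfl, hA, fun i hi j hj qi qj hE hτ => ?_⟩
          have hi' := hA i hi qi
          have hj' := hA j hj qj
          have e := hS.answer hP (x := x) hE hτ
          refine ⟨?_, ?_⟩
          · exact (received_of_ne_null hi').trans (e.trans (received_of_ne_null hj').symm)
          · rw [hT₁ i hi, hT₁ j hj, after_succ, after_succ, history_step_of_ne_null hi',
              history_step_of_ne_null hj']
            have e' : P x (V.after P x (bits i) (T i)).history
                (V.symOf (V.after P x (bits i) (T i)).state) =
              P x (V.after P x (bits j) (T j)).history
                (V.symOf (V.after P x (bits j) (T j)).state) := e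
            rw [e']
            exact hS.cons _ hE hτ
    · change (V.after P x (bits i) (T₁ i)).inputHead = (V.after P x (bits i) (T i)).inputHead + _
      beta_reduce
      by_cases hi : i ∈ A
      · rw [hT₁ i hi, after_succ, inputHead_step, if_pos hi]
      · rw [hT₁' i hi, if_neg hi]
        simp
  by_cases hsil : ∃ i ∈ K, (∃ q, (V.after P x (bits i) (T i)).state = .run q) ∧
      V.symOf (V.after P x (bits i) (T i)).state = V.null
  · obtain ⟨i, hi, hq, hs⟩ := hsil
    refine main {i} (.inl ?_) ⟨i, hi, rfl, hq⟩
    rintro j rfl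
    exact hs
  · push Not at hsil
    exact main K (.inr ⟨rfl, fun i hi hq => hsil i hi hq⟩) ⟨i₀, hi₀, hi₀, hq₀⟩

theorem mem_language_simulator (hS : IsCoherent S τ E) {P : Prover α V.Γ} (hP : P ∈ S)
    (x : List α) (hb : ∀ i t, (V.after P x (bits i) t).memory.Bounded s r)
    (htape : ∀ ω t, OnTape x (V.after P x ω t).inputHead) {K : Set (Fin k)} (hK : K ∈ heavy)
    (hacc : ∀ i ∈ K, ∃ t, (V.after P x (bits i) t).state = .accept) :
    x ∈ (V.simulator τ s r bits heavy).language := by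
  obtain ⟨N, hN⟩ : ∃ N, ∀ i ∈ K, (V.after P x (bits i) N).state = .accept := by
    choose! t ht using hacc
    refine ⟨Finset.univ.sup t, fun i hi => ?_⟩
    rw [after_eq_of_halted (Finset.le_sup (Finset.mem_univ i)) (by rw [ht i hi]; simp)]
    exact ht i hi
  obtain ⟨T', hT', hfin⟩ := exists_simulator_computation (heavy := heavy) hS hP x hb htape hN
    (fun _ => 0)
  refine ⟨_, Relation.ReflTransGen.head ⟨fun _ => 0, ?_, fun i => ⟨?_, ?_⟩⟩ hT', ?_⟩
  · exact ⟨K, _, hK, fun _ _ => hS.nil, rfl⟩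
  · rfl
  · exact htape (bits i) 0
  · exact ⟨K, _, _, rfl, hfin⟩

theorem exists_prover_of_mem_language_simulator (hS : IsCoherent S τ E) (hne : S.Nonempty)
    {x : List α} (hx : x ∈ (V.simulator τ s r bits heavy).language) :
    ∃ P ∈ S, ∃ K ∈ heavy, ∀ i ∈ K, ∃ t, (V.after P x (bits i) t).state = .accept := by
  obtain ⟨c, hc, K, m, same, e, hacc⟩ := hx
  rcases exists_prover_of_simulator hS hne x hc with rfl | ⟨K', m', same', e', hK', P, hP, n, T, h, -⟩
  · cases e
  · rw [e] at e'
    cases e'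
    refine ⟨P, hP, K, hK', fun i hi => ⟨T i, ?_⟩⟩
    rw [← hacc i hi, ← (h i hi).1]
    rfl

end Verifier

/-! ### Computations of an automaton in which every step moves a head -/

namespace MultiheadNFA

variable {α : Type} {k : ℕ} (M : MultiheadNFA α k)

/-- Some steps without head movements, with scanned symbols `σ`. -/
def Stays (σ : Fin k → Option α) : M.Q → M.Q → Prop :=
  Relation.ReflTransGen fun q q' => (q', fun _ => 0) ∈ M.next q σ

/-- Some steps without head movements, followed by a step with head movements `d`. -/
def Advances (σ : Fin k → Option α) (q q' : M.Q) (d : Fin k → SignType) : Prop :=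
  ∃ p, M.Stays σ q p ∧ (q', d) ∈ M.next p σ ∧ ∃ i, d i ≠ 0

/-- An accepting state can be reached without head movements. -/
def Finishes (σ : Fin k → Option α) (q : M.Q) : Prop :=
  ∃ p, M.Stays σ q p ∧ p ∈ M.accept

variable {M} {x : List α}

theorem reflTransGen_step_of_stays {q q' : M.Q} {pos : Fin k → ℤ} (hpos : ∀ i, OnTape x (pos i))
    (h : M.Stays (fun i => tapeSymbol x (pos i)) q q') :
    Relation.ReflTransGen (M.Step x) (q, pos) (q', pos) := by
  induction h with
  | refl => exact .refl
  | tail _ h ih => exact ih.tail ⟨fun _ => 0, h, fun i => ⟨by simp, hpos i⟩⟩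

theorem mem_language_of_finishes {q : M.Q} {pos : Fin k → ℤ} (hpos : ∀ i, OnTape x (pos i))
    (h : Relation.ReflTransGen (M.Step x) (M.start, fun _ => 0) (q, pos))
    (hf : M.Finishes (fun i => tapeSymbol x (pos i)) q) : x ∈ M.language := by
  obtain ⟨p, hp, ha⟩ := hf
  exact ⟨_, h.trans (reflTransGen_step_of_stays hpos hp), ha⟩

/-- The step relation whose steps consist of an `Advances` transition. -/
def BigStep (M : MultiheadNFA α k) (x : List α) (c c' : M.Q × (Fin k → ℤ)) : Prop :=
  ∃ d : Fin k → SignType, M.Advances (fun i => tapeSymbol x (c.2 i)) c.1 c'.1 d ∧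
    ∀ i, c'.2 i = c.2 i + (d i : ℤ) ∧ OnTape x (c'.2 i)

/-- A step that moves no head leaves the scanned symbols unchanged, so it can be absorbed into the
next moving step or into the final `Finishes`. -/
theorem exists_bigStep {c c' : M.Q × (Fin k → ℤ)} (h : Relation.ReflTransGen (M.Step x) c c')
    (ha : c'.1 ∈ M.accept) :
    ∃ c₁, Relation.ReflTransGen (M.BigStep x) c c₁ ∧
      M.Finishes (fun i => tapeSymbol x (c₁.2 i)) c₁.1 := by
  induction h using Relation.ReflTransGen.head_induction_on with
  | refl => exact ⟨c', .refl, _, .refl, ha⟩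
  | @head c c₁ hstep _ ih =>
    obtain ⟨c₂, h₂, hf⟩ := ih
    obtain ⟨d, hd, hpos⟩ := hstep
    by_cases hd0 : ∃ i, d i ≠ 0
    · exact ⟨c₂, h₂.head ⟨d, ⟨_, .refl, hd, hd0⟩, hpos⟩, hf⟩
    · push Not at hd0
      obtain rfl : d = fun _ => 0 := funext hd0
      have e : c₁.2 = c.2 := funext fun i => by simpa using (hpos i).1
      rcases Relation.ReflTransGen.cases_head h₂ with rfl | ⟨c₃, ⟨d', ⟨p, hp, hpd⟩, hpos'⟩, h₃⟩
      · obtain ⟨p, hp, hpa⟩ := hf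
        rw [e] at hp
        refine ⟨c, .refl, p, Relation.ReflTransGen.head hd hp, hpa⟩
      · rw [e] at hp hpd hpos'
        exact ⟨c₂, h₃.head ⟨d', ⟨p, Relation.ReflTransGen.head hd hp, hpd⟩, hpos'⟩, hf⟩

end MultiheadNFA

theorem Relation.ReflTransGen.exists_seq {β : Type*} {ρ : β → β → Prop} {a b : β}
    (h : Relation.ReflTransGen ρ a b) :
    ∃ (n : ℕ) (f : ℕ → β), f 0 = a ∧ f n = b ∧ ∀ t < n, ρ (f t) (f (t + 1)) := by
  induction h using Relation.ReflTransGen.head_induction_on with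
  | refl => exact ⟨0, fun _ => b, rfl, rfl, fun t ht => absurd ht (Nat.not_lt_zero t)⟩
  | @head a c hac _ ih =>
    obtain ⟨n, f, h0, hn, hf⟩ := ih
    refine ⟨n + 1, fun t => Nat.casesOn t a f, rfl, hn, fun t ht => ?_⟩
    cases t with
    | zero =>
      rw [← h0] at hac
      exact hac
    | succ t => exact hf t (by omega)

/-! ### Detecting the right end-marker -/

section Tape

variable {α : Type} {x : List α} {p : ℤ} {b : Bool} {d : SignType}

theorem length_lt_of_tapeSymbol_eq_none (hp : 1 ≤ p) (h : tapeSymbol x p = none) :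
    (x.length : ℤ) < p := by
  rw [tapeSymbol, if_pos hp, List.getElem?_eq_none_iff] at h
  omega

theorem tapeSymbol_eq_none (hp : (x.length : ℤ) < p) : tapeSymbol x p = none := by
  rw [tapeSymbol]
  split_ifs
  · rw [List.getElem?_eq_none_iff]
    omega
  · rfl

theorem sign_eq_zero_or_one (hd : d ≠ -1) : d = 0 ∨ d = 1 := by
  revert hd
  cases d <;> decide

/-- Both end-markers read as `none`. The bit `b` tells them apart, so a finite control can detect a
move beyond the right one. -/
theorem onTape_add (hp : OnTape x p) (hb : b = true ↔ 1 ≤ p) (hd : d ≠ -1)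
    (h : ¬ (b = true ∧ tapeSymbol x p = none ∧ d = 1)) :
    OnTape x (p + (d : ℤ)) ∧ ((b || decide (d = 1)) = true ↔ 1 ≤ p + (d : ℤ)) := by
  rcases sign_eq_zero_or_one hd with rfl | rfl
  · simpa using ⟨hp, hb⟩
  · obtain ⟨h0, h1⟩ := hp
    have hle : p ≤ x.length := by
      by_contra hlt
      exact h ⟨hb.2 (by omega), tapeSymbol_eq_none (by omega), rfl⟩
    simp only [SignType.coe_one]
    refine ⟨⟨by omega, by omega⟩, ?_⟩
    simpa using h0

theorem not_leaves_of_onTape (hb : b = true ↔ 1 ≤ p) (h : OnTape x (p + (d : ℤ))) :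
    ¬ (b = true ∧ tapeSymbol x p = none ∧ d = 1) := by
  rintro ⟨hb', hn, rfl⟩
  have := length_lt_of_tapeSymbol_eq_none (hb.1 hb') hn
  have := h.2
  simp only [SignType.coe_one] at this
  omega

end Tape

/-! ### The protocol that checks one secret head -/

namespace MultiheadNFA

variable {α : Type} {k : ℕ}

/-- A message of the prover: the scanned symbols, and an `Advances` transition; without the latter, it
claims that `Finishes` holds. -/
abbrev Message (M : MultiheadNFA α k) : Type :=
  (Fin k → Option α) × Option (M.Q × (Fin k → SignType))

open Classical in
/-- The reaction to a message, in the state `q` of the automaton, when `a` is the symbol scanned by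
the head `i`, and `b` says if this head has left the left end-marker. -/
noncomputable def check (M : MultiheadNFA α k) (R : Type) (i : Fin k) (q : M.Q) (b : Bool)
    (a : Option α) : Option M.Message → VState R (Fin k × M.Q × Bool) × SignType
  | none => (.reject, 0)
  | some (σ, none) => if σ i = a ∧ M.Finishes σ q then (.accept, 0) else (.reject, 0)
  | some (σ, some (q', d)) =>
      -- Every run checks in full that the transition fits the claimed symbols; only the entry `σ i`
      -- is compared with the tape.
      if σ i = a ∧ M.Advances σ q q' d ∧ ¬ (b = true ∧ a = none ∧ d i = 1) then
        (.run (.inr (i, q', b || decide (d i = 1))), d i)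
      else (.reject, 0)

/-- The verifier that tosses `r + 1` coins to choose, by `f`, to reject or to check one head of the
automaton. -/
noncomputable def protocol [Finite α] (M : MultiheadNFA α k) (r : ℕ)
    (f : (Fin (r + 1) → Bool) → Option (Fin k)) : Verifier α where
  R := Fin (r + 1) × (Fin (r + 1) → Bool)
  D := Fin k × M.Q × Bool
  Γ := Option M.Message
  Θ := Unit
  finite_R := inferInstance
  finite_D := by
    have := M.finite_Q
    infer_instance
  finite_Γ := by
    have := M.finite_Q
    infer_instance
  finite_Θ := inferInstance
  null := none
  blank := ()
  start := .inl (0, fun _ => false)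
  sym
    | .inl _ => none
    -- Any fixed symbol other than `null` would do: it tells the prover nothing about the chosen
    -- head.
    | .inr _ => some (fun _ => none, none)
  tossStep p _ _ _ b :=
    (if h : p.1.1 + 1 < r + 1 then .run (.inl (⟨p.1.1 + 1, h⟩, Function.update p.2 p.1 b))
      else match f (Function.update p.2 p.1 b) with
        | none => .reject
        | some i => .run (.inr (i, M.start, false)), (), 0, 0)
  detStep p a _ g :=
    ((M.check (Fin (r + 1) × (Fin (r + 1) → Bool)) p.1 p.2.1 p.2.2 a g).1, (),
      (M.check (Fin (r + 1) × (Fin (r + 1) → Bool)) p.1 p.2.1 p.2.2 a g).2, 0)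

variable {M : MultiheadNFA α k}

theorem check_snd_ne (hM : M.OneWay) (R : Type) (i : Fin k) (q : M.Q) (b : Bool) (a : Option α)
    (g : Option M.Message) : (M.check R i q b a g).2 ≠ -1 := by
  rcases g with _ | ⟨σ, _ | ⟨q', d⟩⟩
  · simp [check]
  · rw [check]
    split_ifs <;> simp
  · rw [check]
    split_ifs with h
    · obtain ⟨p, -, hp, -⟩ := h.2.1
      exact hM _ _ _ _ hp i
    · simp

/-- The communication so far, after `t` communication steps with the protocol. -/
def dialogue (P : Prover α (Option M.Message)) (x : List α) : ℕ →
    List (Option M.Message × Option M.Message)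
  | 0 => []
  | t + 1 => (some (fun _ => none, none), P x (dialogue P x t) (some (fun _ => none, none))) ::
      dialogue P x t

theorem length_dialogue (P : Prover α (Option M.Message)) (x : List α) (t : ℕ) :
    (dialogue P x t).length = t := by
  induction t with
  | zero => rfl
  | succ t ih => rw [dialogue, List.length_cons, ih]

/-- The message in a communication step. -/
def message (P : Prover α (Option M.Message)) (x : List α) (t : ℕ) : Option M.Message :=
  P x (dialogue P x t) (some (fun _ => none, none))

variable [Finite α] {r : ℕ} {f : (Fin (r + 1) → Bool) → Option (Fin k)}

theorem protocol_oneWayInput (hM : M.OneWay) : (M.protocol r f).OneWayInput :=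
  ⟨fun _ _ _ _ _ => by simp [protocol], fun _ _ _ _ => check_snd_ne hM _ _ _ _ _ _⟩

variable {P : Prover α (M.protocol r f).Γ} {x : List α} {ω : ℕ → Bool}

theorem step_check {c : (M.protocol r f).Snapshot} {i : Fin k} {q : M.Q} {b : Bool}
    (hc : c.state = .run (.inr (i, q, b))) {t : ℕ} (ht : c.history = dialogue P x t) :
    ((M.protocol r f).step P x ω c).state =
        (M.check _ i q b (tapeSymbol x c.inputHead) (message P x t)).1 ∧
      ((M.protocol r f).step P x ω c).inputHead = c.inputHead +
        ((M.check (Fin (r + 1) × (Fin (r + 1) → Bool)) i q b (tapeSymbol x c.inputHead)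
          (message P x t)).2 : ℤ) ∧
      ((M.protocol r f).step P x ω c).history = dialogue P x (t + 1) := by
  obtain ⟨⟨s, p, w, wh⟩, h, n⟩ := c
  cases hc
  cases ht
  refine ⟨?_, ?_, ?_⟩ <;>
    simp [Verifier.step, Verifier.perform, Verifier.exchange, protocol, message, dialogue]

theorem after_toss (t : ℕ) (ht : t < r + 1) :
    ((M.protocol r f).after P x ω t).state =
        .run (.inl (⟨t, ht⟩, fun i => if i.1 < t then ω i else false)) ∧
      ((M.protocol r f).after P x ω t).inputHead = 0 ∧
      ((M.protocol r f).after P x ω t).history = [] ∧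
      ((M.protocol r f).after P x ω t).coins = t := by
  induction t with
  | zero => exact ⟨rfl, rfl, rfl, rfl⟩
  | succ t ih =>
    obtain ⟨h1, h2, h3, h4⟩ := ih (by omega)
    rw [Verifier.after_succ]
    generalize (M.protocol r f).after P x ω t = c at h1 h2 h3 h4
    obtain ⟨⟨s, p, w, wh⟩, h, n⟩ := c
    cases h1
    cases h2
    cases h3
    obtain rfl : t = n := h4.symm
    refine ⟨?_, ?_, ?_, ?_⟩
    · simp only [Verifier.step, Verifier.perform, protocol]
      rw [dif_pos ht]
      congr 3
      funext i
      rcases lt_trichotomy i.1 t with h | h | h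
      · rw [Function.update_of_ne (by rintro rfl; exact lt_irrefl _ h), if_pos h, if_pos (by omega)]
      · rw [show i = ⟨t, by omega⟩ from Fin.ext h]
        simp
      · rw [Function.update_of_ne (by rintro rfl; exact lt_irrefl _ h), if_neg (by omega),
          if_neg (by omega)]
    · simp [Verifier.step, Verifier.perform, protocol]
    · simp [Verifier.step, Verifier.perform, Verifier.exchange, protocol]
    · simp [Verifier.step, Verifier.perform]

theorem after_all_tosses :
    ((M.protocol r f).after P x ω (r + 1)).state =
        (match f (fun i => ω i) with
          | none => .reject
          | some i => .run (.inr (i, M.start, false))) ∧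
      ((M.protocol r f).after P x ω (r + 1)).inputHead = 0 ∧
      ((M.protocol r f).after P x ω (r + 1)).history = [] := by
  obtain ⟨h1, h2, h3, h4⟩ := after_toss (M := M) (f := f) (P := P) (x := x) (ω := ω) r (by omega)
  rw [Verifier.after_succ]
  generalize (M.protocol r f).after P x ω r = c at h1 h2 h3 h4
  obtain ⟨⟨s, p, w, wh⟩, h, n⟩ := c
  cases h1
  cases h2
  cases h3
  obtain rfl : r = n := h4.symm
  refine ⟨?_, ?_, ?_⟩
  · simp only [Verifier.step, Verifier.perform, protocol]
    rw [dif_neg (lt_irrefl _)]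
    congr 2
    funext i
    by_cases h : i.1 = r
    · rw [show i = ⟨r, by omega⟩ from Fin.ext h]
      simp
    · rw [Function.update_of_ne (by rintro rfl; exact h rfl), if_pos (by omega)]
  · simp [Verifier.step, Verifier.perform, protocol]
  · simp [Verifier.step, Verifier.perform, Verifier.exchange, protocol]

/-- The clause on coin-tossing states is needed to bound the coins; the last one, that the stored
bit is correct, is needed to keep the head on the tape. -/
theorem protocol_invariant (hM : M.OneWay) (t : ℕ) :
    let c := (M.protocol r f).after P x ω t
    c.workHead = 0 ∧ c.coins ≤ r + 1 ∧ OnTape x c.inputHead ∧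
      (∀ p, c.state = .run (.inl p) → c.inputHead = 0 ∧ c.coins = p.1) ∧
      ∀ p, c.state = .run (.inr p) → (p.2.2 = true ↔ 1 ≤ c.inputHead) := by
  induction t with
  | zero =>
    refine ⟨rfl, Nat.zero_le _, ⟨le_rfl, ?_⟩, ?_, ?_⟩
    · change (0 : ℤ) ≤ _
      omega
    · rintro p hp
      cases hp
      exact ⟨rfl, rfl⟩
    · intro p hp
      cases hp
  | succ t ih =>
    intro c'
    have hc' : c' = (M.protocol r f).step P x ω ((M.protocol r f).after P x ω t) :=
      Verifier.after_succ t
    clear_value c'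
    subst hc'
    generalize (M.protocol r f).after P x ω t = c at ih ⊢
    obtain ⟨⟨s, p, w, wh⟩, h, n⟩ := c
    obtain ⟨h1, h2, h3, h4, h5⟩ := ih
    cases h1
    rcases s with (⟨j, u⟩ | ⟨i, q, b⟩) | _ | _
    · obtain ⟨h6, h7⟩ := h4 _ rfl
      cases h6
      cases h7
      refine ⟨rfl, j.2, h3, ?_, ?_⟩
      · intro p hp
        refine ⟨rfl, ?_⟩
        simp only [Verifier.step, Verifier.perform, protocol] at hp
        split_ifs at hp with hj
        · cases hp
          rfl
        · split at hp <;> cases hp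
      · intro p hp
        simp only [Verifier.step, Verifier.perform, protocol] at hp
        split_ifs at hp with hj
        · cases hp
        split at hp
        · cases hp
        · cases hp
          simp [Verifier.step, Verifier.perform, protocol]
    · have h6 := h5 _ rfl
      simp only [Verifier.step, Verifier.perform]
      generalize ((M.protocol r f).exchange P x (Sum.inr (i, q, b)) h).1 = g
      simp only [protocol]
      refine ⟨by simp, h2, ?_⟩
      have stay : OnTape x (p + ((0 : SignType) : ℤ)) := by simpa using h3
      rcases g with _ | ⟨σ, _ | ⟨q', d⟩⟩
      · exact ⟨stay, fun _ hp => (by cases hp), fun _ hp => by cases hp⟩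
      · simp only [check]
        split_ifs
        · exact ⟨stay, fun _ hp => (by cases hp), fun _ hp => by cases hp⟩
        · exact ⟨stay, fun _ hp => (by cases hp), fun _ hp => by cases hp⟩
      · simp only [check]
        split_ifs with hcond
        · obtain ⟨-, ⟨p', -, hp', -⟩, hcond⟩ := hcond
          obtain ⟨h7, h8⟩ := onTape_add h3 h6 (hM _ _ _ _ hp' i) hcond
          exact ⟨h7, fun _ hp => (by cases hp), fun _ hp => by cases hp; exact h8⟩
        · exact ⟨stay, fun _ hp => (by cases hp), fun _ hp => by cases hp⟩
    · exact ⟨rfl, h2, h3, fun _ hp => (by cases hp), fun _ hp => by cases hp⟩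
    · exact ⟨rfl, h2, h3, fun _ hp => (by cases hp), fun _ hp => by cases hp⟩

theorem protocol_accepts {σ : ℕ → M.Message} {T : ℕ} {s : ℕ → M.Q × (Fin k → ℤ)}
    {d : ℕ → Fin k → SignType} (hP : ∀ t, message P x t = some (σ t))
    (hs : s 0 = (M.start, fun _ => 0))
    (hσ : ∀ t, (σ t).1 = fun i => tapeSymbol x ((s t).2 i))
    (hσ' : ∀ t < T, (σ t).2 = some ((s (t + 1)).1, d t)) (hT : (σ T).2 = none)
    (hd : ∀ t < T, M.Advances (fun i => tapeSymbol x ((s t).2 i)) (s t).1 (s (t + 1)).1 (d t) ∧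
      ∀ i, (s (t + 1)).2 i = (s t).2 i + (d t i : ℤ) ∧ OnTape x ((s (t + 1)).2 i))
    (hfin : M.Finishes (fun i => tapeSymbol x ((s T).2 i)) (s T).1)
    (hM : M.OneWay) {i : Fin k} (hi : f (fun j => ω j) = some i) :
    ∃ t, ((M.protocol r f).after P x ω t).state = .accept := by
  have main : ∀ t ≤ T, ∃ b, ((M.protocol r f).after P x ω (r + 1 + t)).state =
        .run (.inr (i, (s t).1, b)) ∧
      ((M.protocol r f).after P x ω (r + 1 + t)).inputHead = (s t).2 i ∧
      ((M.protocol r f).after P x ω (r + 1 + t)).history = dialogue P x t := by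
    intro t
    induction t with
    | zero =>
      intro _
      obtain ⟨h1, h2, h3⟩ := after_all_tosses (M := M) (f := f) (P := P) (x := x) (ω := ω)
      rw [hi] at h1
      exact ⟨false, by rw [hs]; exact h1, by rw [hs]; exact h2, h3⟩
    | succ t ih =>
      intro ht
      obtain ⟨b, h1, h2, h3⟩ := ih (by omega)
      have hb := (protocol_invariant (P := P) (x := x) (ω := ω) (f := f) hM (r + 1 + t)).2.2.2.2 _ h1
      obtain ⟨h4, h5, h6⟩ := step_check (ω := ω) h1 h3
      have e : σ t = (fun i => tapeSymbol x ((s t).2 i), some ((s (t + 1)).1, d t)) :=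
        Prod.ext (hσ t) (hσ' t ht)
      obtain ⟨hd1, hd2⟩ := hd t ht
      have hcond := not_leaves_of_onTape hb (by rw [h2, ← (hd2 i).1]; exact (hd2 i).2)
      rw [hP, e, check, if_pos ⟨by rw [h2], hd1, hcond⟩] at h4 h5
      rw [← add_assoc, Verifier.after_succ]
      exact ⟨_, h4, by rw [h5, h2, (hd2 i).1], h6⟩
  obtain ⟨b, h1, h2, h3⟩ := main T le_rfl
  obtain ⟨h4, -, -⟩ := step_check (ω := ω) h1 h3
  have e : σ T = (fun i => tapeSymbol x ((s T).2 i), none) := Prod.ext (hσ T) hT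
  rw [hP, e, check, if_pos ⟨by rw [h2], hfin⟩] at h4
  exact ⟨r + 1 + T + 1, by rw [Verifier.after_succ]; exact h4⟩

theorem exists_oneWay_prover (hM : M.OneWay) (r : ℕ) (f : (Fin (r + 1) → Bool) → Option (Fin k)) :
    ∃ P : Prover α (M.protocol r f).Γ, P.IsOneWay ∧ ∀ x ∈ M.language, ∀ ω i,
      f (fun j => ω j) = some i → ∃ t, ((M.protocol r f).after P x ω t).state = .accept := by
  have key : ∀ x : List α, ∃ m : ℕ → M.Message, x ∈ M.language →
      ∀ P : Prover α (M.protocol r f).Γ, (∀ t, message P x t = some (m t)) → ∀ ω i,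
        f (fun j => ω j) = some i → ∃ t, ((M.protocol r f).after P x ω t).state = .accept := by
    intro x
    by_cases hx : x ∈ M.language
    · obtain ⟨c, hc, ha⟩ := hx
      obtain ⟨c₁, h₁, hfin⟩ := exists_bigStep hc ha
      obtain ⟨T, s, h0, hT, hs⟩ := h₁.exists_seq
      choose! d hd using hs
      refine ⟨fun t => (fun i => tapeSymbol x ((s t).2 i),
        if t < T then some ((s (t + 1)).1, d t) else none), fun _ P hP ω i hi => ?_⟩
      exact protocol_accepts (T := T) (d := d) hP h0 (fun _ => rfl) (fun t ht => if_pos ht)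
        (if_neg (lt_irrefl _)) hd (hT.symm ▸ hfin) hM hi
    · exact ⟨fun _ => (fun _ => none, none), fun h => absurd h hx⟩
  choose m hm using key
  refine ⟨fun x h _ => some (m x h.length), ⟨fun x t => some (m x t), fun _ _ _ => rfl⟩, ?_⟩
  intro x hx ω i hi
  refine hm x hx _ (fun t => ?_) ω i hi
  exact congrArg (fun n => some (m x n)) (length_dialogue _ x t)

/-- Runs that check different heads hold the same dialogue. If each head had a run that never
rejects, these runs together would confirm every claimed symbol, and the messages would describe a
genuine computation. It cannot finish, as `x` is not in the language, and it cannot continue, as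
each message increases the sum of the head positions. -/
theorem exists_rejecting_head (hM : M.OneWay) [NeZero k] (hx : x ∉ M.language)
    (P : Prover α (M.protocol r f).Γ) :
    ∃ i, ∀ ω, f (fun j => ω j) = some i →
      ∃ t, ((M.protocol r f).after P x ω t).state = .reject := by
  by_contra! hcon
  choose ω hω hrej using hcon
  have main : ∀ t : ℕ, ∃ (q : M.Q) (pos : Fin k → ℤ),
      Relation.ReflTransGen (M.Step x) (M.start, fun _ => 0) (q, pos) ∧
      (∀ i, OnTape x (pos i)) ∧ (t : ℤ) ≤ ∑ i, pos i ∧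
      ∀ i, (∃ b, ((M.protocol r f).after P x (ω i) (r + 1 + t)).state = .run (.inr (i, q, b))) ∧
        ((M.protocol r f).after P x (ω i) (r + 1 + t)).inputHead = pos i ∧
        ((M.protocol r f).after P x (ω i) (r + 1 + t)).history = dialogue P x t := by
    intro t
    induction t with
    | zero =>
      refine ⟨M.start, fun _ => 0, .refl, fun _ => ⟨le_rfl, by positivity⟩, by simp, fun i => ?_⟩
      obtain ⟨h1, h2, h3⟩ := after_all_tosses (M := M) (f := f) (P := P) (x := x) (ω := ω i)
      rw [hω i] at h1
      exact ⟨⟨false, h1⟩, h2, h3⟩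
    | succ t ih =>
      obtain ⟨q, pos, hreach, htape, hsum, hrun⟩ := ih
      have hstep : ∀ i, ∃ b, (b = true ↔ 1 ≤ pos i) ∧
          ((M.protocol r f).after P x (ω i) (r + 1 + (t + 1))).state =
            (M.check _ i q b (tapeSymbol x (pos i)) (message P x t)).1 ∧
          ((M.protocol r f).after P x (ω i) (r + 1 + (t + 1))).inputHead = pos i +
            ((M.check (Fin (r + 1) × (Fin (r + 1) → Bool)) i q b (tapeSymbol x (pos i))
              (message P x t)).2 : ℤ) ∧
          ((M.protocol r f).after P x (ω i) (r + 1 + (t + 1))).history = dialogue P x (t + 1) := by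
        intro i
        obtain ⟨⟨b, h1⟩, h2, h3⟩ := hrun i
        have hb := (protocol_invariant (P := P) (x := x) (ω := ω i) (f := f) hM
          (r + 1 + t)).2.2.2.2 _ h1
        have := step_check (ω := ω i) h1 h3
        rw [h2] at this hb
        rw [← add_assoc, Verifier.after_succ]
        exact ⟨b, hb, this⟩
      choose b hb hst hhd hhist using hstep
      have hnr : ∀ i, (M.check (Fin (r + 1) × (Fin (r + 1) → Bool)) i q (b i)
          (tapeSymbol x (pos i)) (message P x t)).1 ≠ .reject :=
        fun i h => hrej i _ ((hst i).trans h)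
      generalize message P x t = g at hst hhd hnr
      rcases g with _ | ⟨σ, _ | ⟨q', d⟩⟩
      · exact absurd rfl (hnr 0)
      · have hcond : ∀ i, σ i = tapeSymbol x (pos i) ∧ M.Finishes σ q := by
          intro i
          by_contra h
          exact hnr i (by rw [check, if_neg h])
        have hσ : σ = fun i => tapeSymbol x (pos i) := funext fun i => (hcond i).1
        exact absurd (mem_language_of_finishes htape hreach (hσ ▸ (hcond 0).2)) hx
      · have hcond : ∀ i, σ i = tapeSymbol x (pos i) ∧ M.Advances σ q q' d ∧
            ¬ (b i = true ∧ tapeSymbol x (pos i) = none ∧ d i = 1) := by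
          intro i
          by_contra h
          exact hnr i (by rw [check, if_neg h])
        have hσ : σ = fun i => tapeSymbol x (pos i) := funext fun i => (hcond i).1
        obtain ⟨p, hp, hpd, i₀, hi₀⟩ := (hcond 0).2.1
        have hd : ∀ i, d i ≠ -1 := hM _ _ _ _ hpd
        have htape' : ∀ i, OnTape x (pos i + (d i : ℤ)) := fun i =>
          (onTape_add (htape i) (hb i) (hd i) (hcond i).2.2).1
        refine ⟨q', fun i => pos i + (d i : ℤ), ?_, htape', ?_, fun i => ⟨?_, ?_, hhist i⟩⟩
        · rw [hσ] at hp hpd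
          exact (hreach.trans (reflTransGen_step_of_stays htape hp)).tail
            ⟨d, hpd, fun i => ⟨rfl, htape' i⟩⟩
        · rw [Finset.sum_add_distrib, Nat.cast_succ]
          refine add_le_add hsum ?_
          have hnn : ∀ i ∈ Finset.univ, (0 : ℤ) ≤ (d i : ℤ) := by
            intro i _
            rcases sign_eq_zero_or_one (hd i) with h | h <;> simp [h]
          refine le_trans ?_ (Finset.single_le_sum hnn (Finset.mem_univ i₀))
          simp [(sign_eq_zero_or_one (hd i₀)).resolve_left hi₀]
        · rw [hst i, check, if_pos (hcond i)]
          exact ⟨_, rfl⟩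
        · rw [hhd i, check, if_pos (hcond i)]
  -- The sum of `k` positions is at most `k * (x.length + 1)`; one more message is too many.
  obtain ⟨q, pos, -, htape, hsum, -⟩ := main (k * (x.length + 1) + 1)
  have hle : ∑ i, pos i ≤ ∑ _i : Fin k, ((x.length : ℤ) + 1) :=
    Finset.sum_le_sum fun i _ => (htape i).2
  rw [Finset.sum_const, Finset.card_univ, Fintype.card_fin, nsmul_eq_mul] at hle
  push_cast at hsum
  linarith

end MultiheadNFA

/-! ### Probabilities of events that depend on finitely many coins -/

instance : IsProbabilityMeasure coinMeasure := by
  unfold coinMeasure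
  infer_instance

theorem measurable_prefix (r : ℕ) : Measurable fun (ω : ℕ → Bool) (j : Fin r) => ω j :=
  measurable_pi_lambda _ fun j => measurable_pi_apply (j : ℕ)

theorem measurableSet_prefix {r : ℕ} (B : Set (Fin r → Bool)) :
    MeasurableSet {ω : ℕ → Bool | (fun j : Fin r => ω j) ∈ B} :=
  measurable_prefix r B.toFinite.measurableSet

theorem coinMeasure_prefix_eq {r : ℕ} (u : Fin r → Bool) :
    coinMeasure.real {ω | (fun j : Fin r => ω j) = u} = (1 / 2) ^ r := by
  have h : {ω : ℕ → Bool | (fun j : Fin r => ω j) = u} = Set.pi (Finset.range r : Set ℕ)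
      (fun n => {b | ∀ h : n < r, b = u ⟨n, h⟩}) := by
    ext ω
    simp only [Set.mem_ofPred_eq, Set.mem_pi, Finset.coe_range, Set.mem_Iio, funext_iff]
    exact ⟨fun h n _ hn => h ⟨n, hn⟩, fun h j => h j j.2 j.2⟩
  rw [h, measureReal_def, coinMeasure, Measure.infinitePi_pi _ fun _ _ => MeasurableSet.of_discrete,
    Finset.prod_congr rfl (g := fun _ => (2 : ENNReal)⁻¹), Finset.prod_const, Finset.card_range]
  · simp
  · intro n hn
    have hs : {b | ∀ h : n < r, b = u ⟨n, h⟩} = {u ⟨n, Finset.mem_range.1 hn⟩} := by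
      ext b
      simp [Finset.mem_range.1 hn]
    rw [hs, PMF.toMeasure_apply_singleton _ _ (MeasurableSet.singleton _)]
    simp

theorem coinMeasure_prefix_mem {r : ℕ} (B : Finset (Fin r → Bool)) :
    coinMeasure.real {ω | (fun j : Fin r => ω j) ∈ B} = B.card / 2 ^ r := by
  have h : {ω : ℕ → Bool | (fun j : Fin r => ω j) ∈ B} =
      ⋃ u ∈ B, {ω | (fun j : Fin r => ω j) = u} := by
    ext ω
    simp
  rw [h, measureReal_biUnion_finset]
  · simp [coinMeasure_prefix_eq, div_eq_mul_inv]
  · intro u _ v _ huv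
    rw [Function.onFun, Set.disjoint_left]
    rintro ω rfl rfl
    exact huv rfl
  · exact fun u _ => measurableSet_prefix {u}

/-! ### From verifiers to automata -/

namespace Verifier

variable {α : Type}

theorem exists_oneWayNFA (V : Verifier α) {S : Set (Prover α V.Γ)} {τ : V.Γ → V.Γ → Prop}
    {E : List (V.Γ × V.Γ) → List (V.Γ × V.Γ) → Prop} (hS : IsCoherent S τ E) {L : Language α}
    (hV : V.Verifies S L) : ∃ k, 1 ≤ k ∧ L ∈ OneWayNFA α k := by
  obtain ⟨htape, ⟨s, hs⟩, ⟨r, hr⟩, hone, ε, -, hε, ⟨P₀, hP₀, hcomp⟩, hsound⟩ := hV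
  let e := Fintype.equivFin (Fin r → Bool)
  let bits : Fin (Fintype.card (Fin r → Bool)) → ℕ → Bool :=
    -- Bits from index `r` on are never read, so `false` is an arbitrary choice.
    fun i n => if h : n < r then e.symm i ⟨n, h⟩ else false
  let idx : (ℕ → Bool) → Fin (Fintype.card (Fin r → Bool)) := fun ω => e fun j => ω j
  have hbits : ∀ P ∈ S, ∀ x ω t, V.after P x (bits (idx ω)) t = V.after P x ω t := by
    intro P hP x ω t
    refine after_congr_coins (fun n hn => ?_) (hr P hP x ω) t
    simp [bits, idx, hn]
  have hmeas : ∀ K : Set (Fin (Fintype.card (Fin r → Bool))), MeasurableSet {ω | idx ω ∈ K} :=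
    fun K => measurableSet_prefix (e ⁻¹' K)
  refine ⟨_, Fintype.card_pos, V.simulator τ s r bits {K | 1 / 2 < coinMeasure.real {ω | idx ω ∈ K}},
    simulator_oneWay hone, ?_⟩
  ext x
  constructor
  · intro hx
    by_contra hxL
    obtain ⟨P, hP, K, hK, hacc⟩ := exists_prover_of_mem_language_simulator hS ⟨P₀, hP₀⟩ hx
    have hrej := hsound x hxL P hP
    have hdisj : Disjoint {ω | ∃ t, (V.after P x ω t).state = .reject} {ω | idx ω ∈ K} := by
      rw [Set.disjoint_left]
      rintro ω ⟨t, ht⟩ hω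
      obtain ⟨t', ht'⟩ := hacc _ hω
      rw [hbits P hP] at ht'
      rcases le_total t t' with h | h
      · rw [after_eq_of_halted h (by simp [ht]), ht] at ht'
        cases ht'
      · rw [after_eq_of_halted h (by simp [ht']), ht'] at ht
        cases ht
    -- The rejection event and the guessed set are disjoint and both have probability above `1 / 2`.
    have hle := measureReal_le_one (μ := coinMeasure)
      (s := {ω | ∃ t, (V.after P x ω t).state = .reject} ∪ {ω | idx ω ∈ K})
    rw [measureReal_union hdisj (hmeas K)] at hle
    have hK' : 1 / 2 < coinMeasure.real {ω | idx ω ∈ K} := hK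
    rw [rejectProb] at hrej
    linarith
  · intro hx
    refine mem_language_simulator (K := {i | ∃ t, (V.after P₀ x (bits i) t).state = .accept}) hS hP₀ x
      (fun i t => bounded_memory_after (hs P₀ hP₀ x _) (hr P₀ hP₀ x _) t) (htape P₀ hP₀ x) ?_
      fun i hi => hi
    have h := hcomp x hx
    rw [acceptProb] at h
    change 1 / 2 < coinMeasure.real {ω | ∃ t, (V.after P₀ x (bits (idx ω)) t).state = .accept}
    simp only [hbits P₀ hP₀]
    linarith

end Verifier

/-! ### From automata to verifiers -/

/-- Of the `2 ^ (r + 1)` outcomes, `2 ^ r - 1` reject outright, and the other `2 ^ r + 1` are shared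
among the heads so that each gets at least two. Adding two to the former gives `2 ^ r + 1` again, a
majority in both cases. -/
theorem exists_head_choice (k : ℕ) [NeZero k] : ∃ (r : ℕ) (f : (Fin (r + 1) → Bool) → Option (Fin k)),
    2 ^ r + 1 ≤ (Finset.univ.filter fun u => f u ≠ none).card ∧
      ∀ i, 2 ^ r + 1 ≤ (Finset.univ.filter fun u => f u = none ∨ f u = some i).card := by
  have hk : 0 < k := Nat.pos_of_neZero k
  -- Half the number of outcomes; `2 * k ≤ m` leaves room for two outcomes per head.
  obtain ⟨m, hm, hkm⟩ : ∃ m, m = 2 ^ (2 * k) ∧ 2 * k ≤ m := ⟨_, rfl, Nat.lt_two_pow_self.le⟩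
  have e : (Fin (2 * k + 1) → Bool) ≃ Fin (2 * m) := Fintype.equivFinOfCardEq (by
    simp [hm, pow_succ, mul_comm])
  refine ⟨2 * k, fun u => if (e u).1 < m - 1 then none
    else some ⟨((e u).1 - (m - 1)) / 2 % k, Nat.mod_lt _ hk⟩, ?_, fun i => ?_⟩
  · rw [← hm]
    refine le_of_eq_of_le (Fintype.card_fin (m + 1)).symm (Finset.card_le_card_of_injOn
      (fun j => e.symm ⟨j.1 + (m - 1), by omega⟩) (fun j _ => ?_) fun j _ j' _ h => ?_)
    · simp
      omega
    · have := Fin.mk.inj (e.symm.injective h)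
      exact Fin.ext (by omega)
  · rw [← hm]
    refine le_of_eq_of_le (Fintype.card_fin (m + 1)).symm (Finset.card_le_card_of_injOn
      -- The last two indices, `m - 1` and `m`, are shifted to a pair of outcomes that select head
      -- `i`.
      (fun j => e.symm ⟨if j.1 < m - 1 then j.1 else j.1 + 2 * i.1, by split_ifs <;> omega⟩)
      (fun j _ => ?_) fun j _ j' _ h => ?_)
    · have hj := j.2
      simp only [Finset.coe_filter, Finset.mem_univ, true_and, Set.mem_ofPred_eq,
        Equiv.apply_symm_apply]
      by_cases h : j.1 < m - 1
      · simp [h]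
      · right
        have h1 : ¬ (j.1 + 2 * i.1 < m - 1) := by omega
        have h2 : (j.1 + 2 * i.1 - (m - 1)) / 2 = i.1 := by omega
        simp only [if_neg h, if_neg h1, h2, Nat.mod_eq_of_lt i.2]
    · have := Fin.mk.inj (e.symm.injective h)
      refine Fin.ext ?_
      split_ifs at this <;> omega

/-- Completeness needs only a one-way prover and soundness holds against all provers, so one
verifier serves every class in between. -/
theorem MultiheadNFA.exists_verifier {α : Type} [Finite α] {k : ℕ} (hk : 1 ≤ k)
    (M : MultiheadNFA α k) (hM : M.OneWay) :
    ∃ V : Verifier α, ∀ S : Set (Prover α V.Γ), {P | P.IsOneWay} ⊆ S → V.Verifies S M.language := by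
  have : NeZero k := ⟨by omega⟩
  obtain ⟨r, f, hacc, hrej⟩ := exists_head_choice k
  -- `2 ^ r + 1` out of `2 ^ (r + 1)` outcomes have probability `1 / 2 + 1 / 2 ^ (r + 1)`, which
  -- dictates the error `1 / 2 - 1 / 2 ^ (r + 1)`.
  have hprob : ∀ (B : Finset (Fin (r + 1) → Bool)) (A : Set (ℕ → Bool)), 2 ^ r + 1 ≤ B.card →
      (∀ ω : ℕ → Bool, (fun j : Fin (r + 1) => ω j) ∈ B → ω ∈ A) →
      1 - (1 / 2 - 1 / 2 ^ (r + 1)) ≤ coinMeasure.real A := by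
    intro B A hB hA
    refine le_trans ?_ ((coinMeasure_prefix_mem B).symm.trans_le (measureReal_mono hA))
    rw [le_div_iff₀ (by positivity)]
    have : (2 : ℝ) ^ r + 1 ≤ B.card := by exact_mod_cast hB
    refine le_trans (le_of_eq ?_) this
    field_simp
    ring
  refine ⟨M.protocol r f, fun S hS => ⟨fun P _ x ω t => (protocol_invariant hM t).2.2.1,
    ⟨1, fun P _ x ω => ?_⟩, ⟨r + 1, fun P _ x ω t => (protocol_invariant hM t).2.1⟩,
    protocol_oneWayInput hM, 1 / 2 - 1 / 2 ^ (r + 1), ?_, ?_, ?_, ?_⟩⟩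
  · refine (Set.encard_le_encard (t := {0}) ?_).trans (Set.encard_singleton _).le
    rintro _ ⟨t, rfl⟩
    exact (protocol_invariant hM t).1
  · rw [sub_nonneg]
    gcongr
    exact le_self_pow₀ one_le_two (by omega)
  · exact sub_lt_self _ (by positivity)
  · obtain ⟨P, hP, hPacc⟩ := exists_oneWay_prover hM r f
    refine ⟨P, hS hP, fun x hx => hprob _ _ hacc fun ω hω => ?_⟩
    rw [Finset.mem_filter] at hω
    obtain ⟨i, hi⟩ := Option.ne_none_iff_exists'.1 hω.2
    exact hPacc x hx ω i hi
  · intro x hx P _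
    obtain ⟨i, hi⟩ := exists_rejecting_head (f := f) hM hx P
    refine hprob _ _ (hrej i) fun ω hω => ?_
    rw [Finset.mem_filter] at hω
    rcases hω.2 with h | h
    · refine ⟨r + 1, ?_⟩
      rw [after_all_tosses.1, h]
    · exact hi ω h

theorem theorem4p1 (α : Type) [Finite α] :
    OneWayIPConsOneWayInput α = IPConsOneWayInput α ∧
      IPConsOneWayInput α = ⋃ (k : ℕ) (_ : 1 ≤ k), OneWayNFA α k := by
  have h1 : OneWayIPConsOneWayInput α = ⋃ (k : ℕ) (_ : 1 ≤ k), OneWayNFA α k := by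
    ext L
    simp only [Set.mem_iUnion, exists_prop]
    constructor
    · rintro ⟨V, hV⟩
      exact V.exists_oneWayNFA (isCoherent_oneWay α V.Γ) hV
    · rintro ⟨k, hk, M, hM, rfl⟩
      obtain ⟨V, hV⟩ := M.exists_verifier hk hM
      exact ⟨V, hV _ subset_rfl⟩
  have h2 : IPConsOneWayInput α = ⋃ (k : ℕ) (_ : 1 ≤ k), OneWayNFA α k := by
    ext L
    simp only [Set.mem_iUnion, exists_prop]
    constructor
    · rintro ⟨V, hV⟩
      exact V.exists_oneWayNFA (isCoherent_univ α V.Γ) hV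
    · rintro ⟨k, hk, M, hM, rfl⟩
      obtain ⟨V, hV⟩ := M.exists_verifier hk hM
      exact ⟨V, hV _ (Set.subset_univ _)⟩
  exact ⟨h1.trans h2.symm, h2⟩
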